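/- Let $k$ be a field and $C$ a (coassociative, counital) $k$-coalgebra with comultiplication $\Delta$ and counit $\epsilon$. An element $g\in C$ is set-like if $\Delta(g)=g\otimes g$ and $\epsilon(g)=1$; for a set $G$, $C[G]$ denotes the coalgebra with basis $G$ in which every $g\in G$ is set-like. A simply colored coalgebra is a triple $(C,G,\delta)$, where $G$ is a set of set-like elements of $C$ and $\delta\colon C\to C[G]$ is a coalgebra homomorphism that is a left inverse of the canonical map $\iota\colon C[G]\to C$, $g\mapsto g$, such that for every $x\in\ker\delta$ there is an $N$ with $\overline{\Delta}^N(x)=0$; here $\overline{\Delta}=\Delta-(\iota\delta\otimes\mathrm{id})\Delta-(\mathrm{id}\otimes\iota\delta)\Delta$ and $\overline{\Delta}^N$ is its $N$-th iterate. The coradical $C_0$ of $C$ is the sum of all cosimple subcoalgebras of $C$, i.e. of the nonzero subcoalgebras whose only subcoalgebras are $0$ and themselves; $C$ is pointed if every cosimple subcoalgebra is one-dimensional. A pointed coalgebra with a splitting is a pair $(C,\delta)$ of a pointed coalgebra $C$ and a coalgebra homomorphism $\delta\colon C\to C_0$ that restricts to the identity on $C_0$ (so that $C=C_0\oplus\ker\delta$).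 1. If $(C,G,\delta)$ is a simply colored coalgebra over $k$, then $C$ is pointed and $\iota\delta$, viewed as a map $C\to C_0$, is well defined and makes $C$ a pointed coalgebra with a splitting. 2. Conversely, let $(C,\delta)$ be a pointed coalgebra with a splitting over $k$, and let $G$ be the set of all set-like elements of $C$. Then there is a coalgebra homomorphism $\delta'\colon C\to C[G]$ with $\iota\delta'=\delta$ (as maps to $C$) such that $(C,G,\delta')$ is a simply colored coalgebra. 3. For each $k$-coalgebra $C$, the assignment $(C,G,\delta)\mapsto(C,\iota\delta)$ is a bijection from the simply colored coalgebra structures on $C$ onto the structures of a pointed coalgebra with a splitting on $C$. -/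

import Mathlib

open scoped TensorProduct

/-! ### Simply colored coalgebras over a commutative ring -/

section SimplyColored

variable {R C : Type*} [CommRing R] [AddCommGroup C] [Module R C]

/-- The canonical linear map `C[G] → C`, `g ↦ g`, for a subset `G` of `C`. Here `C[G]` is the free
module `G →₀ R`; Mathlib's coalgebra structure on it makes every basis element `g` set-like. -/
noncomputable def colorInclusion (R : Type*) {C : Type*} [CommRing R] [AddCommGroup C] [Module R C]
    (G : Set C) : (G →₀ R) →ₗ[R] C :=
  Finsupp.linearCombination R (fun g : G => (g : C))

variable [Coalgebra R C]

/-- The reduced comultiplication `Δ - (p ⊗ id) ∘ Δ - (id ⊗ p) ∘ Δ` attached to an endomorphism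
`p` of `C` (in the applications, a retraction of `C` followed by the inclusion into `C`). -/
noncomputable def reducedComul (p : C →ₗ[R] C) : C →ₗ[R] C ⊗[R] C :=
  Coalgebra.comul - LinearMap.rTensor C p ∘ₗ Coalgebra.comul
    - LinearMap.lTensor C p ∘ₗ Coalgebra.comul

/-- The iterates `C → C^{⊗ (n + 1)}` of a linear map `D : C → C ⊗ C`: the `0`-th iterate is the
identity and the `(n + 1)`-st one is `(D^n ⊗ id) ∘ D`. -/
noncomputable def iteratedComul (D : C →ₗ[R] C ⊗[R] C) : (n : ℕ) → C →ₗ[R] (⨂[R]^(n + 1) C)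
  | 0 => (PiTensorProduct.subsingletonEquiv (R := R) (s := fun _ : Fin 1 => C) 0).symm.toLinearMap
  | n + 1 => TensorPower.mulEquiv.toLinearMap ∘ₗ
      TensorProduct.map (iteratedComul D n)
        (PiTensorProduct.subsingletonEquiv (R := R) (s := fun _ : Fin 1 => C) 0).symm.toLinearMap ∘ₗ D

variable (R C) in
/-- The structure of a simply colored coalgebra `(C, G, δ)` on the coalgebra `C`. -/
structure SimplyColored where
  /-- the set `G` of colors -/
  colors : Set C
  /-- colors are set-like -/
  setLike : ∀ g ∈ colors, IsGroupLikeElem R g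
  /-- the coalgebra homomorphism `δ : C → C[G]` -/
  δ : C →ₗc[R] (colors →₀ R)
  /-- `δ` is a retraction: it is a left inverse of `C[G] → C` -/
  δ_inclusion : ∀ a : colors →₀ R, δ (colorInclusion R colors a) = a
  /-- every element of `ker δ` is killed by an iterate of the reduced comultiplication -/
  conilpotent : ∀ x : C, δ x = 0 →
    ∃ N : ℕ, iteratedComul (reducedComul (colorInclusion R colors ∘ₗ δ.toLinearMap)) N x = 0

end SimplyColored

/-! ### Pointed coalgebras with a splitting over a field -/

section Pointed

variable {k C : Type*} [Field k] [AddCommGroup C] [Module k C] [Coalgebra k C]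

variable (k) in
/-- A subspace `D` is a subcoalgebra if `Δ(D) ⊆ D ⊗ D`, where `D ⊗ D` is regarded as a subspace
of `C ⊗ C`. -/
def IsSubcoalgebra (D : Submodule k C) : Prop :=
  ∀ x ∈ D, (Coalgebra.comul x : C ⊗[k] C) ∈
    LinearMap.range (TensorProduct.map D.subtype D.subtype)

/-- A subcoalgebra `D` is cosimple if it is nonzero and its only subcoalgebras are `0` and `D`. -/
structure IsCosimple (D : Submodule k C) : Prop where
  isSubcoalgebra : IsSubcoalgebra k D
  ne_bot : D ≠ ⊥
  eq_bot_or_eq : ∀ E : Submodule k C, IsSubcoalgebra k E → E ≤ D → E = ⊥ ∨ E = D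

variable (k C) in
/-- The coradical: the sum of all cosimple subcoalgebras. -/
def coradical : Submodule k C :=
  sSup {D : Submodule k C | IsCosimple D}

variable (k C) in
/-- A coalgebra is pointed if all its cosimple subcoalgebras are one-dimensional. -/
def IsPointedCoalgebra : Prop :=
  ∀ D : Submodule k C, IsCosimple D → Module.finrank k D = 1

theorem map_subtype_injective {k C : Type*} [Field k] [AddCommGroup C] [Module k C]
    (D : Submodule k C) :
    Function.Injective (TensorProduct.map D.subtype D.subtype) :=
  TensorProduct.map_injective_of_flat_flat _ _ D.injective_subtype D.injective_subtype

/-- The comultiplication of a subcoalgebra. -/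
noncomputable def subComul {D : Submodule k C} (hD : IsSubcoalgebra k D) : D →ₗ[k] D ⊗[k] D :=
  (LinearEquiv.ofInjective _ (map_subtype_injective D)).symm.toLinearMap ∘ₗ
    LinearMap.codRestrict (LinearMap.range (TensorProduct.map D.subtype D.subtype))
      (Coalgebra.comul ∘ₗ D.subtype) (fun x => hD x x.2)

theorem map_comp_subComul {D : Submodule k C} (hD : IsSubcoalgebra k D) :
    TensorProduct.map D.subtype D.subtype ∘ₗ subComul hD = Coalgebra.comul ∘ₗ D.subtype := by
  ext x
  have h := LinearEquiv.apply_symm_apply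
    (LinearEquiv.ofInjective _ (map_subtype_injective D))
    (LinearMap.codRestrict (LinearMap.range (TensorProduct.map D.subtype D.subtype))
      (Coalgebra.comul ∘ₗ D.subtype) (fun x => hD x x.2) x)
  exact congrArg Subtype.val h

/-- The coalgebra structure of a subcoalgebra, restricted from the ambient coalgebra. -/
@[reducible] noncomputable def IsSubcoalgebra.coalgebra {D : Submodule k C}
    (hD : IsSubcoalgebra k D) : Coalgebra k D where
  comul := subComul hD
  counit := Coalgebra.counit ∘ₗ D.subtype
  coassoc := by
    have hinj : Function.Injective
        (TensorProduct.map D.subtype (TensorProduct.map D.subtype D.subtype)) :=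
      TensorProduct.map_injective_of_flat_flat _ _ D.injective_subtype (map_subtype_injective D)
    have h := map_comp_subComul hD
    refine LinearMap.ext fun x => hinj ?_
    have e1 : TensorProduct.map D.subtype (TensorProduct.map D.subtype D.subtype) ∘ₗ
        (TensorProduct.assoc k D D D).toLinearMap ∘ₗ (subComul hD).rTensor D ∘ₗ subComul hD =
        (TensorProduct.assoc k C C C).toLinearMap ∘ₗ
          (Coalgebra.comul (R := k) (A := C)).rTensor C ∘ₗ Coalgebra.comul ∘ₗ D.subtype := by
      rw [← h, ← LinearMap.comp_assoc, TensorProduct.map_map_comp_assoc_eq, LinearMap.comp_assoc]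
      congr 1
      rw [← LinearMap.comp_assoc, ← LinearMap.comp_assoc]
      congr 1
      rw [LinearMap.map_comp_rTensor, LinearMap.rTensor_comp_map, h]
    have e2 : TensorProduct.map D.subtype (TensorProduct.map D.subtype D.subtype) ∘ₗ
        (subComul hD).lTensor D ∘ₗ subComul hD =
        (Coalgebra.comul (R := k) (A := C)).lTensor C ∘ₗ Coalgebra.comul ∘ₗ D.subtype := by
      rw [← h, ← LinearMap.comp_assoc, ← LinearMap.comp_assoc]
      congr 1
      rw [LinearMap.map_comp_lTensor, LinearMap.lTensor_comp_map, h]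
    have e3 := congrArg (fun f => f ∘ₗ D.subtype) (Coalgebra.coassoc (R := k) (A := C))
    simp only [LinearMap.comp_assoc] at e3
    exact LinearMap.congr_fun (e1.trans (e3.trans e2.symm)) x
  rTensor_counit_comp_comul := by
    have hinj : Function.Injective (D.subtype.lTensor k) :=
      Module.Flat.lTensor_preserves_injective_linearMap _ D.injective_subtype
    have h := map_comp_subComul hD
    refine LinearMap.ext fun x => hinj ?_
    have e1 : D.subtype.lTensor k ∘ₗ (Coalgebra.counit ∘ₗ D.subtype).rTensor D ∘ₗ subComul hD =
        (Coalgebra.counit (R := k) (A := C)).rTensor C ∘ₗ Coalgebra.comul ∘ₗ D.subtype := by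
      rw [← h, ← LinearMap.comp_assoc, ← LinearMap.comp_assoc]
      congr 1
      rw [LinearMap.lTensor_comp_rTensor, LinearMap.rTensor_comp_map]
    have e2 := LinearMap.congr_fun e1 x
    simpa using e2
  lTensor_counit_comp_comul := by
    have hinj : Function.Injective (D.subtype.rTensor k) :=
      Module.Flat.rTensor_preserves_injective_linearMap _ D.injective_subtype
    have h := map_comp_subComul hD
    refine LinearMap.ext fun x => hinj ?_
    have e1 : D.subtype.rTensor k ∘ₗ (Coalgebra.counit ∘ₗ D.subtype).lTensor D ∘ₗ subComul hD =
        (Coalgebra.counit (R := k) (A := C)).lTensor C ∘ₗ Coalgebra.comul ∘ₗ D.subtype := by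
      rw [← h, ← LinearMap.comp_assoc, ← LinearMap.comp_assoc]
      congr 1
      rw [LinearMap.rTensor_comp_lTensor, LinearMap.lTensor_comp_map]
    have e2 := LinearMap.congr_fun e1 x
    simpa using e2

theorem isSubcoalgebra_coradical : IsSubcoalgebra k (coradical k C) := by
  have key : coradical k C ≤ (LinearMap.range (TensorProduct.map (coradical k C).subtype
      (coradical k C).subtype)).comap Coalgebra.comul := by
    refine sSup_le fun D hD x hx => ?_
    have hle : D ≤ coradical k C := le_sSup hD
    obtain ⟨y, hy⟩ := hD.isSubcoalgebra x hx
    refine ⟨TensorProduct.map (Submodule.inclusion hle) (Submodule.inclusion hle) y, ?_⟩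
    rw [← hy, TensorProduct.map_map]
    rfl
  exact fun x hx => key hx

/-- The coradical is a coalgebra, as a subcoalgebra of `C`. -/
noncomputable instance : Coalgebra k (coradical k C) :=
  isSubcoalgebra_coradical.coalgebra

variable (k C) in
/-- The structure of a pointed coalgebra with a splitting `(C, δ)` on the coalgebra `C`. -/
structure PointedSplitting where
  /-- `C` is pointed -/
  pointed : IsPointedCoalgebra k C
  /-- the coalgebra homomorphism `δ` from `C` to its coradical -/
  δ : C →ₗc[k] coradical k C
  /-- `δ` splits the inclusion of the coradical; in particular it is surjective and `C` is the
  direct sum of the coradical and `ker δ` -/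
  δ_coe : ∀ x : coradical k C, δ (x : C) = x

end Pointed

/-!
A simply colored structure and a splitting carry the same data, the coalgebra endomorphism `p = ιδ`
of `C`: a projection onto the span of the set-like elements involved. What has to be compared is
conilpotence of `ker p` with the range of `p` being the coradical, and both are translated into the
dual algebra `C*` (functionals with the convolution product). Let `I` be the ideal of functionals
vanishing on the range of `p`. On `ker p` the reduced comultiplication is `(q ⊗ q) ∘ Δ` with
`q = id - p`, so the vanishing of its `n`-th iterate at `x ∈ ker p` is a statement about products of
`n + 1` elements of `I` evaluated at `x` (`iteratedComul_eq_zero`, `exists_apply_iteratedComul`).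

Given a simply colored coalgebra, let `D` be a nonzero subcoalgebra. If `D` met the span of the colors
trivially, some `f ∈ I` would agree with the counit `ε` on `D`; then every power of `f`
agrees with `ε` on `D` while conilpotence makes some power vanish at each element, so `ε = 0` on `D`
and `D = 0`. Hence `D` meets the span of the colors, and acting on a nonzero common element with a
coefficient functional of `δ` yields a color in `D` (`SimplyColored.exists_color_mem`). So the
cosimple subcoalgebras are exactly the lines spanned by colors: `C` is pointed, the range of `p` is
the coradical, and all set-like elements are colors, which gives injectivity in the last part.

Conversely, in a pointed coalgebra the coradical is the span of the linearly independent set-like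
elements, so a splitting factors through `C[G]`. Conilpotence is
`exists_pow_annihilatorIdeal_coradical`, valid for every coalgebra: `x` lies in a finite-dimensional
subcoalgebra `E`, and `C*` modulo the annihilator of `E` is an Artinian ring whose Jacobson
radical is nilpotent and, by Wedderburn–Artin, an intersection of maximal two-sided ideals. The
common kernel in `C` of such an ideal is cosimple, so functionals vanishing on the coradical lie in
all of them.
-/

/-! ### Two-sided ideals of Artinian rings -/

/-- An element of an Artinian ring outside the Jacobson radical is avoided by some maximal two-sided
ideal: modulo the radical the ring is a product of matrix rings over division rings, and the element
has a nonzero component in one of these simple factors. -/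
theorem exists_isTwoSided_of_notMem_jacobson {R : Type*} [Ring R] [IsArtinianRing R] {x : R}
    (hx : x ∉ Ring.jacobson R) :
    ∃ L : Ideal R, L.IsTwoSided ∧ x ∉ L ∧
      ∀ M : Ideal R, M.IsTwoSided → L ≤ M → M = L ∨ M = ⊤ := by
  obtain ⟨n, D, d, _, hd, ⟨e⟩⟩ :=
    IsSemisimpleRing.exists_ringEquiv_pi_matrix_divisionRing (R ⧸ Ring.jacobson R)
  set y := e (Ideal.Quotient.mk (Ring.jacobson R) x) with hy
  have hy0 : y ≠ 0 := by
    simpa [hy, Ideal.Quotient.eq_zero_iff_mem] using hx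
  obtain ⟨i, hi⟩ := Function.ne_iff.mp hy0
  let φ : R →+* Matrix (Fin (d i)) (Fin (d i)) (D i) :=
    (Pi.evalRingHom _ i).comp (e.toRingHom.comp (Ideal.Quotient.mk (Ring.jacobson R)))
  have hφ : Function.Surjective φ :=
    (Function.surjective_eval i).comp (e.surjective.comp Ideal.Quotient.mk_surjective)
  refine ⟨RingHom.ker φ, inferInstance, hi, fun M _ hM => or_iff_not_imp_right.mpr fun hne => ?_⟩
  have : Nontrivial (R ⧸ M) := Ideal.Quotient.nontrivial_iff.mpr hne
  have hM' : RingHom.ker φ ≤ RingHom.ker (Ideal.Quotient.mk M) := by rwa [Ideal.mk_ker]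
  have hinj := (φ.liftOfSurjective hφ ⟨Ideal.Quotient.mk M, hM'⟩).injective
  refine le_antisymm (fun z hz => ?_) hM
  refine hinj ?_
  rw [RingHom.liftOfRightInverse_comp_apply, map_zero]
  exact Ideal.Quotient.eq_zero_iff_mem.mpr hz

/-! ### The dual algebra acting on a coalgebra -/

section DualAction

variable {k C : Type*} [Field k] [AddCommGroup C] [Module k C] [Coalgebra k C]

open Coalgebra WithConv

/-- The left action `f ⇀ x = (id ⊗ f) (Δ x)` of the dual algebra on a coalgebra. -/
noncomputable def leftHit (f : WithConv (C →ₗ[k] k)) : C →ₗ[k] C :=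
  (TensorProduct.rid k C).toLinearMap ∘ₗ f.ofConv.lTensor C ∘ₗ comul

/-- The right action `x ↼ f = (f ⊗ id) (Δ x)` of the dual algebra on a coalgebra. -/
noncomputable def rightHit (f : WithConv (C →ₗ[k] k)) : C →ₗ[k] C :=
  (TensorProduct.lid k C).toLinearMap ∘ₗ f.ofConv.rTensor C ∘ₗ comul

theorem apply_leftHit (f g : WithConv (C →ₗ[k] k)) (x : C) :
    f.ofConv (leftHit g x) = (f * g).ofConv x := by
  have : f.ofConv ∘ₗ (TensorProduct.rid k C).toLinearMap ∘ₗ g.ofConv.lTensor C =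
      LinearMap.mul' k k ∘ₗ TensorProduct.map f.ofConv g.ofConv := by
    ext a b; simp [mul_comm]
  exact LinearMap.congr_fun this (comul x)

theorem apply_rightHit (f g : WithConv (C →ₗ[k] k)) (x : C) :
    f.ofConv (rightHit g x) = (g * f).ofConv x := by
  have : f.ofConv ∘ₗ (TensorProduct.lid k C).toLinearMap ∘ₗ g.ofConv.rTensor C =
      LinearMap.mul' k k ∘ₗ TensorProduct.map g.ofConv f.ofConv := by
    ext a b; simp
  exact LinearMap.congr_fun this (comul x)

variable (k) in
theorem ext_of_forall_conv {V : Type*} [AddCommGroup V] [Module k V] {x y : V}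
    (h : ∀ f : WithConv (V →ₗ[k] k), f.ofConv x = f.ofConv y) : x = y := by
  rw [← sub_eq_zero, ← Module.forall_dual_apply_eq_zero_iff k]
  intro f
  rw [map_sub, sub_eq_zero]
  exact h (toConv f)

theorem leftHit_mul (f g : WithConv (C →ₗ[k] k)) (x : C) :
    leftHit (f * g) x = leftHit f (leftHit g x) :=
  ext_of_forall_conv k fun h => by simp only [apply_leftHit, mul_assoc]

theorem rightHit_mul (f g : WithConv (C →ₗ[k] k)) (x : C) :
    rightHit (f * g) x = rightHit g (rightHit f x) :=
  ext_of_forall_conv k fun h => by simp only [apply_rightHit, mul_assoc]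

theorem leftHit_rightHit (f g : WithConv (C →ₗ[k] k)) (x : C) :
    leftHit f (rightHit g x) = rightHit g (leftHit f x) :=
  ext_of_forall_conv k fun h => by simp only [apply_leftHit, apply_rightHit, mul_assoc]

theorem leftHit_one (x : C) : leftHit (1 : WithConv (C →ₗ[k] k)) x = x :=
  ext_of_forall_conv k fun h => by simp only [apply_leftHit, mul_one]

theorem rightHit_one (x : C) : rightHit (1 : WithConv (C →ₗ[k] k)) x = x :=
  ext_of_forall_conv k fun h => by simp only [apply_rightHit, one_mul]

/-- A tensor is zero as soon as all its slices by functionals on the second factor are. -/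
theorem tensor_eq_zero_of_lTensor {V W : Type*} [AddCommGroup V] [Module k V] [AddCommGroup W]
    [Module k W] {t : V ⊗[k] W}
    (h : ∀ f : W →ₗ[k] k, TensorProduct.rid k V (f.lTensor V t) = 0) : t = 0 := by
  classical
  apply (TensorProduct.equivFinsuppOfBasisRight (M := V) (Module.Basis.ofVectorSpace k W)).injective
  ext i
  rw [TensorProduct.equivFinsuppOfBasisRight_apply, h, map_zero, Finsupp.zero_apply]

theorem tensor_eq_zero_of_rTensor {V W : Type*} [AddCommGroup V] [Module k V] [AddCommGroup W]
    [Module k W] {t : V ⊗[k] W}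
    (h : ∀ f : V →ₗ[k] k, TensorProduct.lid k W (f.rTensor W t) = 0) : t = 0 := by
  classical
  apply (TensorProduct.equivFinsuppOfBasisLeft (N := W) (Module.Basis.ofVectorSpace k V)).injective
  ext i
  rw [TensorProduct.equivFinsuppOfBasisLeft_apply, h, map_zero, Finsupp.zero_apply]

/-- A tensor lies in `D ⊗ D` as soon as all its slices, on either side, lie in `D`: the projection
onto `D` along a complement fixes it on both factors. -/
theorem mem_range_map_subtype {V : Type*} [AddCommGroup V] [Module k V] {D : Submodule k V}
    {t : V ⊗[k] V}
    (hl : ∀ f : V →ₗ[k] k, TensorProduct.rid k V (f.lTensor V t) ∈ D)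
    (hr : ∀ f : V →ₗ[k] k, TensorProduct.lid k V (f.rTensor V t) ∈ D) :
    t ∈ LinearMap.range (TensorProduct.map D.subtype D.subtype) := by
  obtain ⟨π, hπ⟩ := D.subtype.exists_leftInverse_of_injective D.ker_subtype
  set p : V →ₗ[k] V := D.subtype ∘ₗ π with hp
  have hfix : ∀ x ∈ D, p x = x := fun x hx =>
    congrArg Subtype.val (LinearMap.congr_fun hπ ⟨x, hx⟩)
  have h1 : p.rTensor V t = t := by
    rw [← sub_eq_zero]
    refine tensor_eq_zero_of_lTensor fun f => ?_
    have : (TensorProduct.rid k V).toLinearMap ∘ₗ f.lTensor V ∘ₗ p.rTensor V =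
        p ∘ₗ (TensorProduct.rid k V).toLinearMap ∘ₗ f.lTensor V := by
      ext a b; simp
    have h2 := LinearMap.congr_fun this t
    simp only [LinearMap.comp_apply, LinearEquiv.coe_coe] at h2
    rw [map_sub, map_sub, h2, hfix _ (hl f), sub_self]
  have h2 : p.lTensor V t = t := by
    rw [← sub_eq_zero]
    refine tensor_eq_zero_of_rTensor fun f => ?_
    have : (TensorProduct.lid k V).toLinearMap ∘ₗ f.rTensor V ∘ₗ p.lTensor V =
        p ∘ₗ (TensorProduct.lid k V).toLinearMap ∘ₗ f.rTensor V := by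
      ext a b; simp
    have h2 := LinearMap.congr_fun this t
    simp only [LinearMap.comp_apply, LinearEquiv.coe_coe] at h2
    rw [map_sub, map_sub, h2, hfix _ (hr f), sub_self]
  refine ⟨TensorProduct.map π π t, ?_⟩
  rw [← LinearMap.comp_apply, ← TensorProduct.map_comp]
  have h3 : TensorProduct.map p p t = p.lTensor V (p.rTensor V t) := by
    rw [← LinearMap.comp_apply, LinearMap.lTensor_comp_rTensor]
  exact h3.trans (by rw [h1, h2])

/-- Subcoalgebras are the subspaces stable under both actions of the dual algebra. -/
theorem isSubcoalgebra_iff_hit_mem {D : Submodule k C} :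
    IsSubcoalgebra k D ↔
      ∀ x ∈ D, ∀ f : WithConv (C →ₗ[k] k), leftHit f x ∈ D ∧ rightHit f x ∈ D := by
  refine ⟨fun hD x hx f => ?_, fun h x hx => mem_range_map_subtype
    (fun f => (h x hx (toConv f)).1) (fun f => (h x hx (toConv f)).2)⟩
  obtain ⟨t, ht⟩ := hD x hx
  have h1 : leftHit f x =
      D.subtype (TensorProduct.rid k D ((f.ofConv ∘ₗ D.subtype).lTensor D t)) := by
    have : (TensorProduct.rid k C).toLinearMap ∘ₗ f.ofConv.lTensor C ∘ₗ
        TensorProduct.map D.subtype D.subtype = D.subtype ∘ₗ (TensorProduct.rid k D).toLinearMap ∘ₗ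
          (f.ofConv ∘ₗ D.subtype).lTensor D := by
      ext a b; simp
    have h := LinearMap.congr_fun this t
    simp only [LinearMap.comp_apply, ht] at h
    exact h
  have h2 : rightHit f x =
      D.subtype (TensorProduct.lid k D ((f.ofConv ∘ₗ D.subtype).rTensor D t)) := by
    have : (TensorProduct.lid k C).toLinearMap ∘ₗ f.ofConv.rTensor C ∘ₗ
        TensorProduct.map D.subtype D.subtype = D.subtype ∘ₗ (TensorProduct.lid k D).toLinearMap ∘ₗ
          (f.ofConv ∘ₗ D.subtype).rTensor D := by
      ext a b; simp
    have h := LinearMap.congr_fun this t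
    simp only [LinearMap.comp_apply, ht] at h
    exact h
  exact ⟨h1 ▸ Subtype.property _, h2 ▸ Subtype.property _⟩

/-- The fundamental theorem of coalgebras: every element `x` lies in a finite-dimensional
subcoalgebra. -/
theorem exists_finiteDimensional_isSubcoalgebra (x : C) :
    ∃ E : Submodule k C, IsSubcoalgebra k E ∧ FiniteDimensional k E ∧ x ∈ E := by
  let s : Set C := {y | ∃ f g : WithConv (C →ₗ[k] k), rightHit g (leftHit f x) = y}
  refine ⟨Submodule.span k s, ?_, ?_,
    Submodule.subset_span ⟨1, 1, by rw [leftHit_one, rightHit_one]⟩⟩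
  · refine isSubcoalgebra_iff_hit_mem.mpr fun y hy h => ?_
    constructor
    · refine (Submodule.span_le (p := (Submodule.span k s).comap (leftHit h))).mpr ?_ hy
      rintro _ ⟨f, g, rfl⟩
      exact Submodule.subset_span ⟨h * f, g, by rw [leftHit_mul, leftHit_rightHit]⟩
    · refine (Submodule.span_le (p := (Submodule.span k s).comap (rightHit h))).mpr ?_ hy
      rintro _ ⟨f, g, rfl⟩
      exact Submodule.subset_span ⟨f, g * h, by rw [rightHit_mul]⟩
  · -- The left translates of `x` lie in a finite-dimensional `M`, whose right translates lie in a
    -- finite-dimensional `N`.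
    obtain ⟨M, hM, hxM⟩ := TensorProduct.exists_finite_submodule_left_of_setFinite
      {(comul x : C ⊗[k] C)} (Set.finite_singleton _)
    have hleft : ∀ f : WithConv (C →ₗ[k] k), leftHit f x ∈ M := by
      intro f
      obtain ⟨t, ht⟩ := hxM rfl
      have : (TensorProduct.rid k C).toLinearMap ∘ₗ f.ofConv.lTensor C ∘ₗ M.subtype.rTensor C =
          M.subtype ∘ₗ (TensorProduct.rid k M).toLinearMap ∘ₗ f.ofConv.lTensor M := by
        ext a b; simp
      have h2 := LinearMap.congr_fun this t
      simp only [LinearMap.comp_apply, ht] at h2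
      exact h2 ▸ Subtype.property _
    obtain ⟨S, hS⟩ := Submodule.FG.of_finite (N := M)
    obtain ⟨N, hN, hSN⟩ := TensorProduct.exists_finite_submodule_right_of_setFinite
      ((comul : C →ₗ[k] C ⊗[k] C) '' S) (S.finite_toSet.image _)
    have hright : ∀ g : WithConv (C →ₗ[k] k), ∀ y ∈ M, rightHit g y ∈ N := by
      intro g
      change M ≤ N.comap (rightHit g)
      rw [← hS, Submodule.span_le]
      intro y hy
      obtain ⟨t, ht⟩ := hSN ⟨y, hy, rfl⟩
      have : (TensorProduct.lid k C).toLinearMap ∘ₗ g.ofConv.rTensor C ∘ₗ N.subtype.lTensor C =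
          N.subtype ∘ₗ (TensorProduct.lid k N).toLinearMap ∘ₗ g.ofConv.rTensor N := by
        ext a b; simp
      have h2 := LinearMap.congr_fun this t
      simp only [LinearMap.comp_apply, ht] at h2
      change rightHit g y ∈ N
      exact h2 ▸ Subtype.property _
    refine Submodule.finiteDimensional_of_le (S₂ := N) (Submodule.span_le.mpr ?_)
    rintro _ ⟨f, g, rfl⟩
    exact hright g _ (hleft f)

end DualAction

/-! ### Local nilpotency of the annihilator of the coradical -/

section Nilpotency

variable {k C : Type*} [Field k] [AddCommGroup C] [Module k C] [Coalgebra k C]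

open Coalgebra WithConv

/-- The functionals vanishing on a subcoalgebra, as a left ideal of the dual algebra. -/
noncomputable def annihilatorIdeal {D : Submodule k C} (hD : IsSubcoalgebra k D) :
    Ideal (WithConv (C →ₗ[k] k)) where
  carrier := {f | ∀ x ∈ D, f.ofConv x = 0}
  add_mem' hf hg x hx := by simp [hf x hx, hg x hx]
  zero_mem' x _ := by simp
  smul_mem' g f hf x hx := by
    rw [smul_eq_mul, ← apply_rightHit]
    exact hf _ (isSubcoalgebra_iff_hit_mem.mp hD x hx g).2

theorem mem_annihilatorIdeal {D : Submodule k C} {hD : IsSubcoalgebra k D}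
    {f : WithConv (C →ₗ[k] k)} : f ∈ annihilatorIdeal hD ↔ ∀ x ∈ D, f.ofConv x = 0 :=
  Iff.rfl

instance {D : Submodule k C} (hD : IsSubcoalgebra k D) : (annihilatorIdeal hD).IsTwoSided where
  mul_mem_of_left g hf x hx := by
    rw [← apply_leftHit]
    exact hf _ (isSubcoalgebra_iff_hit_mem.mp hD x hx g).1

/-- The common kernel in `C` of the functionals in a left ideal of the dual algebra. -/
def commonKernel (L : Ideal (WithConv (C →ₗ[k] k))) : Submodule k C where
  carrier := {x | ∀ f ∈ L, f.ofConv x = 0}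
  add_mem' hx hy f hf := by rw [map_add, hx f hf, hy f hf, add_zero]
  zero_mem' f _ := map_zero _
  smul_mem' c x hx f hf := by rw [map_smul, hx f hf, smul_zero]

theorem isSubcoalgebra_commonKernel (L : Ideal (WithConv (C →ₗ[k] k))) [L.IsTwoSided] :
    IsSubcoalgebra k (commonKernel L) := by
  refine isSubcoalgebra_iff_hit_mem.mpr fun x hx g => ⟨fun f hf => ?_, fun f hf => ?_⟩
  · rw [apply_leftHit]
    exact hx _ (L.mul_mem_right g hf)
  · rw [apply_rightHit]
    exact hx _ (L.mul_mem_left g hf)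

/-- A subspace is the common kernel of the functionals that vanish on it. -/
theorem mem_of_forall_annihilator {V : Type*} [AddCommGroup V] [Module k V] {D : Submodule k V}
    {x : V} (h : ∀ f : WithConv (V →ₗ[k] k), (∀ y ∈ D, f.ofConv y = 0) → f.ofConv x = 0) :
    x ∈ D := by
  by_contra hx
  obtain ⟨f, hfx, hf⟩ := Submodule.exists_le_ker_of_notMem hx
  exact hfx (h (toConv f) fun y hy => hf hy)

theorem commonKernel_annihilatorIdeal {D : Submodule k C} (hD : IsSubcoalgebra k D) :
    commonKernel (annihilatorIdeal hD) = D :=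
  le_antisymm (fun _ hx => mem_of_forall_annihilator fun f hf => hx f hf)
    (fun x hx _ hf => hf x hx)

/-- A proper left ideal containing the annihilator of a finite-dimensional subcoalgebra has a nonzero
common kernel. -/
theorem commonKernel_ne_bot {E : Submodule k C} (hE : IsSubcoalgebra k E) [FiniteDimensional k E]
    {L : Ideal (WithConv (C →ₗ[k] k))} (hL : annihilatorIdeal hE ≤ L) (hne : L ≠ ⊤) :
    commonKernel L ≠ ⊥ := by
  intro hbot
  refine hne (eq_top_iff.mpr fun f _ => ?_)
  -- The restrictions to `E` of the functionals in `L` fill up the dual of `E`.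
  let W : Subspace k (Module.Dual k E) :=
    ((L.restrictScalars k).map (WithConv.linearEquiv k (C →ₗ[k] k)).toLinearMap).map
      E.subtype.dualMap
  have hW : W.dualCoannihilator = ⊥ := by
    refine (Submodule.eq_bot_iff _).mpr fun x hx => ?_
    rw [Submodule.mem_dualCoannihilator] at hx
    have : (x : C) ∈ commonKernel L := fun g hg =>
      hx _ ⟨_, ⟨g, hg, rfl⟩, rfl⟩
    rw [hbot, Submodule.mem_bot] at this
    exact Subtype.ext this
  have : FiniteDimensional k (Module.Dual k E) := inferInstance
  have : FiniteDimensional k W := FiniteDimensional.finiteDimensional_submodule W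
  have hWtop : W = ⊤ := by
    rw [← Subspace.dualCoannihilator_dualAnnihilator_eq (W := W), hW]
    exact Submodule.dualAnnihilator_bot
  obtain ⟨_, ⟨g, hg, rfl⟩, hgf⟩ : f.ofConv ∘ₗ E.subtype ∈ W := hWtop ▸ Submodule.mem_top
  have hfg : f - g ∈ L := hL fun x hx => by
    have := LinearMap.congr_fun hgf ⟨x, hx⟩
    simp only [LinearMap.dualMap_apply, LinearMap.comp_apply] at this
    rw [ofConv_sub, LinearMap.sub_apply, sub_eq_zero]
    exact this.symm
  simpa using L.add_mem hfg hg

/-- The quotient by the annihilator of a finite-dimensional subcoalgebra `E` embeds into the dual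
of `E`. -/
theorem isArtinianRing_quotient_annihilatorIdeal {E : Submodule k C} (hE : IsSubcoalgebra k E)
    [FiniteDimensional k E] :
    IsArtinianRing (WithConv (C →ₗ[k] k) ⧸ annihilatorIdeal hE) := by
  let r : WithConv (C →ₗ[k] k) →ₗ[k] Module.Dual k E :=
    E.subtype.dualMap ∘ₗ (WithConv.linearEquiv k (C →ₗ[k] k)).toLinearMap
  have hr : (annihilatorIdeal hE).restrictScalars k = LinearMap.ker r := by
    ext f
    simp only [Submodule.restrictScalars_mem, mem_annihilatorIdeal, LinearMap.mem_ker]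
    refine ⟨fun h => LinearMap.ext fun x => h x x.2, fun h x hx => LinearMap.congr_fun h ⟨x, hx⟩⟩
  have hfin : FiniteDimensional k
      (WithConv (C →ₗ[k] k) ⧸ (annihilatorIdeal hE).restrictScalars k) := by
    rw [hr]
    exact Module.Finite.equiv r.quotKerEquivRange.symm
  have : Module.Finite k (WithConv (C →ₗ[k] k) ⧸ annihilatorIdeal hE) := hfin
  exact IsArtinianRing.of_finite k _

/-- On every element, some power of the ideal of functionals vanishing on the coradical is zero: a
maximal two-sided ideal of finite codimension has a cosimple common kernel, so this ideal maps into
the Jacobson radical of each finite-dimensional quotient given by a subcoalgebra. -/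
theorem exists_pow_annihilatorIdeal_coradical (x : C) :
    ∃ n : ℕ, ∀ f ∈ annihilatorIdeal (isSubcoalgebra_coradical (k := k) (C := C)) ^ n,
      f.ofConv x = 0 := by
  obtain ⟨E, hE, _, hxE⟩ := exists_finiteDimensional_isSubcoalgebra (k := k) x
  have := isArtinianRing_quotient_annihilatorIdeal hE
  set I := annihilatorIdeal (isSubcoalgebra_coradical (k := k) (C := C))
  set π := Ideal.Quotient.mk (annihilatorIdeal hE) with hπ
  have hI : ∀ f ∈ I, π f ∈ Ring.jacobson (WithConv (C →ₗ[k] k) ⧸ annihilatorIdeal hE) := by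
    intro f hf
    by_contra hnot
    obtain ⟨L, hL, hfL, hmax⟩ := exists_isTwoSided_of_notMem_jacobson hnot
    have hmem : f ∉ L.comap π := hfL
    have hle : annihilatorIdeal hE ≤ L.comap π := fun g hg => by
      rw [Ideal.mem_comap, hπ, Ideal.Quotient.eq_zero_iff_mem.mpr hg]
      exact L.zero_mem
    have hmax' : ∀ M : Ideal (WithConv (C →ₗ[k] k)), M.IsTwoSided → L.comap π ≤ M →
        M = L.comap π ∨ M = ⊤ := by
      intro M hM hLM
      have hMπ : (M.map π).comap π = M := by
        rw [Ideal.comap_map_of_surjective π Ideal.Quotient.mk_surjective, sup_eq_left]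
        refine le_trans (fun g hg => hle ?_) hLM
        exact Ideal.Quotient.eq_zero_iff_mem.mp hg
      have h2 : (M.map π).IsTwoSided := ⟨fun {a} b ha => by
        obtain ⟨a, rfl⟩ := Ideal.Quotient.mk_surjective a
        obtain ⟨b, rfl⟩ := Ideal.Quotient.mk_surjective b
        rw [← map_mul]
        have ha' : a ∈ (M.map π).comap π := ha
        rw [hMπ] at ha'
        exact Ideal.mem_map_of_mem π (M.mul_mem_right b ha')⟩
      have h3 : L ≤ M.map π := by
        rw [← Ideal.map_comap_of_surjective π Ideal.Quotient.mk_surjective L]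
        exact Ideal.map_mono hLM
      rcases hmax _ h2 h3 with h | h
      · left; rw [← h, hMπ]
      · right; rw [← hMπ, h, Ideal.comap_top]
    -- By maximality the common kernel of the pulled-back ideal is cosimple, so `f` kills it; hence
    -- `f` lies in that ideal.
    have hne : L.comap π ≠ ⊤ := fun h => hmem (h ▸ Submodule.mem_top)
    have hcosimple : IsCosimple (commonKernel (L.comap π)) := by
      refine ⟨isSubcoalgebra_commonKernel _, commonKernel_ne_bot hE hle hne, fun D hD hDle => ?_⟩
      rcases hmax' (annihilatorIdeal hD) inferInstance (fun g hg y hy => hDle hy g hg) with h | h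
      · right; rw [← h, commonKernel_annihilatorIdeal]
      · left
        rw [← commonKernel_annihilatorIdeal hD, h]
        exact (Submodule.eq_bot_iff _).mpr fun y hy =>
          ext_of_forall_conv k fun g => by rw [hy g Submodule.mem_top, map_zero]
    have hsub : commonKernel (L.comap π) ≤ coradical k C := le_sSup hcosimple
    rcases hmax' (annihilatorIdeal hcosimple.isSubcoalgebra) inferInstance
      (fun g hg y hy => hy g hg) with h | h
    · exact hmem (h ▸ fun y hy => hf y (hsub hy))
    · refine hcosimple.ne_bot ?_
      rw [← commonKernel_annihilatorIdeal hcosimple.isSubcoalgebra, h]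
      exact (Submodule.eq_bot_iff _).mpr fun y hy =>
          ext_of_forall_conv k fun g => by rw [hy g Submodule.mem_top, map_zero]
  obtain ⟨n, hn⟩ := IsSemiprimaryRing.isNilpotent
    (R := WithConv (C →ₗ[k] k) ⧸ annihilatorIdeal hE)
  refine ⟨n, fun f hf => ?_⟩
  have hpow : ∀ m : ℕ, ∀ f ∈ I ^ m,
      π f ∈ Ring.jacobson (WithConv (C →ₗ[k] k) ⧸ annihilatorIdeal hE) ^ m := by
    intro m
    induction m with
    | zero =>
      intro f _
      rw [Submodule.pow_zero, Ideal.one_eq_top]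
      exact Submodule.mem_top
    | succ m ih =>
      suffices h : I ^ (m + 1) ≤ Ideal.comap π
          (Ring.jacobson (WithConv (C →ₗ[k] k) ⧸ annihilatorIdeal hE) ^ (m + 1)) from
        fun f hf => h hf
      rw [Submodule.pow_succ, Submodule.pow_succ]
      exact Ideal.mul_le.mpr fun a ha b hb => by
        rw [Ideal.mem_comap, map_mul]
        exact Ideal.mul_mem_mul (ih a ha) (hI b hb)
  have := hpow n f hf
  rw [hn] at this
  exact Ideal.Quotient.eq_zero_iff_mem.mp this x hxE

end Nilpotency

/-! ### Iterated reduced comultiplications and convolution products -/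

section Iterates

variable {k C : Type*} [Field k] [AddCommGroup C] [Module k C] [Coalgebra k C]

open Coalgebra WithConv

theorem isSubcoalgebra_range (p : C →ₗc[k] C) :
    IsSubcoalgebra k (LinearMap.range p.toLinearMap) := by
  rintro _ ⟨x, rfl⟩
  refine ⟨TensorProduct.map p.toLinearMap.rangeRestrict p.toLinearMap.rangeRestrict (comul x), ?_⟩
  rw [← LinearMap.comp_apply, ← TensorProduct.map_comp]
  exact LinearMap.congr_fun p.map_comp_comul x

/-- On the kernel of an endomorphism `p` of coalgebras, the reduced comultiplication is
`(q ⊗ q) ∘ Δ` with `q = id - p`, because `(p ⊗ p) ∘ Δ = Δ ∘ p` vanishes there. -/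
theorem reducedComul_apply_of_apply_eq_zero (p : C →ₗc[k] C) {x : C} (hx : p x = 0) :
    reducedComul p.toLinearMap x =
      TensorProduct.map (LinearMap.id - p.toLinearMap) (LinearMap.id - p.toLinearMap)
        (comul x) := by
  have h : TensorProduct.map p.toLinearMap p.toLinearMap (comul x) = 0 := by
    have h := LinearMap.congr_fun p.map_comp_comul x
    simp only [LinearMap.comp_apply] at h
    rw [h, show p.toLinearMap x = 0 from hx, map_zero]
  have hexp : TensorProduct.map (LinearMap.id - p.toLinearMap) (LinearMap.id - p.toLinearMap) =
      LinearMap.id - p.toLinearMap.rTensor C - p.toLinearMap.lTensor C +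
        TensorProduct.map p.toLinearMap p.toLinearMap := by
    ext a b
    simp only [TensorProduct.AlgebraTensorModule.curry_apply, TensorProduct.curry_apply,
      LinearMap.coe_restrictScalars, TensorProduct.map_tmul, LinearMap.sub_apply,
      LinearMap.add_apply, LinearMap.id_apply, LinearMap.rTensor_tmul, LinearMap.lTensor_tmul,
      TensorProduct.sub_tmul, TensorProduct.tmul_sub]
    abel
  rw [hexp, LinearMap.add_apply, h, add_zero]
  rfl

/-- If all products of `n + 1` functionals killing the image of the projection `p` vanish at
`x ∈ ker p`, then so does the `n`-th iterate of the reduced comultiplication. -/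
theorem iteratedComul_eq_zero (p : C →ₗc[k] C) (hp : ∀ x, p (p x) = p x) (n : ℕ) :
    ∀ x : C, p x = 0 →
      (∀ f ∈ annihilatorIdeal (isSubcoalgebra_range p) ^ (n + 1), f.ofConv x = 0) →
      iteratedComul (reducedComul p.toLinearMap) n x = 0 := by
  have hq : ∀ g : C →ₗ[k] k, toConv (g ∘ₗ (LinearMap.id - p.toLinearMap)) ∈
      annihilatorIdeal (isSubcoalgebra_range p) := by
    rintro g _ ⟨y, rfl⟩
    change g (p y - p (p y)) = 0
    rw [hp, sub_self, map_zero]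
  induction n with
  | zero =>
    intro x hx h
    have hx0 : x = 0 := ext_of_forall_conv k fun g => by
      have := h _ (by rw [zero_add, Submodule.pow_one]; exact hq g.ofConv)
      rw [map_zero]
      simpa [show p.toLinearMap x = 0 from hx, hx] using this
    rw [hx0, map_zero]
  | succ n ih =>
    intro x hx h
    set it := iteratedComul (reducedComul p.toLinearMap) n with hit
    -- The slice by `g` of the reduced comultiplication at `x ∈ ker p` is `q (g ∘ q ⇀ x)`, which is
    -- again in `ker p`, and `g ∘ q` supplies one more factor from the ideal.
    suffices hz : it.rTensor C (reducedComul p.toLinearMap x) = 0 by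
      simp only [iteratedComul, LinearMap.comp_apply]
      rw [← LinearMap.lTensor_comp_rTensor, LinearMap.comp_apply, hz, map_zero, map_zero]
    refine tensor_eq_zero_of_lTensor fun g => ?_
    set q := LinearMap.id - p.toLinearMap with hqdef
    have hslice : (TensorProduct.rid k _).toLinearMap ∘ₗ g.lTensor _ ∘ₗ it.rTensor C ∘ₗ
        TensorProduct.map q q =
        it ∘ₗ q ∘ₗ (TensorProduct.rid k C).toLinearMap ∘ₗ (g ∘ₗ q).lTensor C := by
      ext a b; simp
    rw [reducedComul_apply_of_apply_eq_zero p hx]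
    refine (LinearMap.congr_fun hslice (comul x)).trans ?_
    change it (q (leftHit (toConv (g ∘ₗ q)) x)) = 0
    set y := leftHit (toConv (g ∘ₗ q)) x with hy
    refine ih _ ?_ fun f hf => ?_
    · change p (y - p y) = 0
      rw [map_sub, hp, sub_self]
    · have hf1 : f ∈ annihilatorIdeal (isSubcoalgebra_range p) :=
        Ideal.pow_le_self n.succ_ne_zero hf
      change f.ofConv (y - p y) = 0
      rw [map_sub, hf1 (p y) ⟨y, rfl⟩, sub_zero, hy, apply_leftHit]
      exact h _ (by rw [Submodule.pow_succ]; exact Ideal.mul_mem_mul hf (hq g))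

/-- For a functional `f` killing the image of the projection `p`, the convolution power `f ^ (n + 1)`
factors on `ker p` through the `n`-th iterate of the reduced comultiplication. -/
theorem exists_apply_iteratedComul (p : C →ₗc[k] C) (hp : ∀ x, p (p x) = p x)
    {f : WithConv (C →ₗ[k] k)} (hf : f ∈ annihilatorIdeal (isSubcoalgebra_range p)) (n : ℕ) :
    ∃ e : (⨂[k]^(n + 1) C) →ₗ[k] k, ∀ x : C, p x = 0 →
      e (iteratedComul (reducedComul p.toLinearMap) n x) = (f ^ (n + 1)).ofConv x := by
  induction n with
  | zero =>
    refine ⟨f.ofConv ∘ₗ (PiTensorProduct.subsingletonEquiv (R := k)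
      (s := fun _ : Fin 1 => C) 0).toLinearMap, fun x _ => ?_⟩
    change _ = (f ^ 1).ofConv x
    rw [pow_one]
    simp [iteratedComul]
  | succ n ih =>
    obtain ⟨e, he⟩ := ih
    set s := PiTensorProduct.subsingletonEquiv (R := k) (s := fun _ : Fin 1 => C) 0
    set it := iteratedComul (reducedComul p.toLinearMap) n with hit
    set q := LinearMap.id - p.toLinearMap with hq
    refine ⟨LinearMap.mul' k k ∘ₗ TensorProduct.map e (f.ofConv ∘ₗ s.toLinearMap) ∘ₗ
      TensorPower.mulEquiv.symm.toLinearMap, fun x hx => ?_⟩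
    have hvanish : ∀ g ∈ annihilatorIdeal (isSubcoalgebra_range p), g.ofConv ∘ₗ q = g.ofConv := by
      intro g hg
      ext y
      change g.ofConv (y - p y) = g.ofConv y
      rw [map_sub, hg (p y) ⟨y, rfl⟩, sub_zero]
    have h1 : e ∘ₗ it ∘ₗ q = (f ^ (n + 1)).ofConv := by
      rw [← hvanish _ (by rw [pow_succ]; exact Ideal.mul_mem_left _ _ hf)]
      ext y
      refine he _ ?_
      change p (y - p y) = 0
      rw [map_sub, hp, sub_self]
    rw [pow_succ f (n + 1)]
    have h2 : TensorProduct.map e (f.ofConv ∘ₗ s.toLinearMap) ∘ₗ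
        TensorProduct.map it s.symm.toLinearMap ∘ₗ TensorProduct.map q q =
        TensorProduct.map (f ^ (n + 1)).ofConv f.ofConv := by
      rw [← h1, ← TensorProduct.map_comp, ← TensorProduct.map_comp]
      congr 1
      conv_rhs => rw [← hvanish f hf]
      ext y
      simp
    rw [LinearMap.convMul_apply, ← h2]
    simp only [iteratedComul, LinearMap.comp_apply, LinearEquiv.coe_coe,
      LinearEquiv.symm_apply_apply]
    rw [reducedComul_apply_of_apply_eq_zero p hx]

end Iterates

/-! ### Set-like elements and the coradical -/

section Colors

variable {k C : Type*} [Field k] [AddCommGroup C] [Module k C] [Coalgebra k C]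

open Coalgebra WithConv

/-- A linear map into `B` is a coalgebra homomorphism if it becomes one after an injective coalgebra
homomorphism out of `B`. -/
noncomputable def CoalgHom.liftInjective {A B : Type*} [AddCommGroup A] [Module k A]
    [Coalgebra k A] [AddCommGroup B] [Module k B] [Coalgebra k B] (j : B →ₗc[k] C)
    (hj : Function.Injective j) (p : A →ₗc[k] C) (f : A →ₗ[k] B)
    (h : j.toLinearMap ∘ₗ f = p.toLinearMap) : A →ₗc[k] B where
  toLinearMap := f
  counit_comp := by
    rw [← j.counit_comp, LinearMap.comp_assoc, h, p.counit_comp]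
  map_comp_comul := by
    have hinj : Function.Injective (TensorProduct.map j.toLinearMap j.toLinearMap) :=
      TensorProduct.map_injective_of_flat_flat _ _ hj hj
    refine LinearMap.ext fun x => hinj ?_
    change (TensorProduct.map j.toLinearMap j.toLinearMap ∘ₗ TensorProduct.map f f ∘ₗ comul) x =
      ((TensorProduct.map j.toLinearMap j.toLinearMap ∘ₗ comul) ∘ₗ f) x
    rw [j.map_comp_comul, LinearMap.comp_assoc, h, ← p.map_comp_comul, ← h, TensorProduct.map_comp,
      LinearMap.comp_assoc]

/-- The inclusion of the coradical, as a coalgebra homomorphism. -/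
noncomputable def coradicalSubtype : coradical k C →ₗc[k] C where
  toLinearMap := (coradical k C).subtype
  counit_comp := rfl
  map_comp_comul := map_comp_subComul isSubcoalgebra_coradical

/-- The canonical map `C[G] → C` for a set `G` of set-like elements, as a coalgebra homomorphism. -/
noncomputable def colorInclusionHom {G : Set C} (hG : ∀ g ∈ G, IsGroupLikeElem k g) :
    (G →₀ k) →ₗc[k] C where
  toLinearMap := colorInclusion k G
  counit_comp := by
    ext g
    simp [colorInclusion, (hG g g.2).counit_eq_one]
  map_comp_comul := by
    ext g
    simp [colorInclusion, (hG g g.2).comul_eq_tmul_self]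

theorem colorInclusion_injective {G : Set C} (hG : ∀ g ∈ G, IsGroupLikeElem k g) :
    Function.Injective (colorInclusion k G) := by
  have h : LinearIndepOn k id G := linearIndepOn_isGroupLikeElem.mono hG
  exact h

theorem range_colorInclusion {V : Type*} [AddCommGroup V] [Module k V] (G : Set V) :
    LinearMap.range (colorInclusion k G) = Submodule.span k G := by
  rw [colorInclusion, Finsupp.range_linearCombination, Subtype.range_coe]

theorem IsGroupLikeElem.isCosimple_span {g : C} (hg : IsGroupLikeElem k g) :
    IsCosimple (Submodule.span k {g}) where
  isSubcoalgebra := by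
    intro x hx
    obtain ⟨c, rfl⟩ := Submodule.mem_span_singleton.mp hx
    let g' : Submodule.span k {g} := ⟨g, Submodule.mem_span_singleton_self g⟩
    exact ⟨c • g' ⊗ₜ g', by simp [g', hg.comul_eq_tmul_self]⟩
  ne_bot := by simpa using hg.ne_zero
  eq_bot_or_eq E _ hE := (nonzero_span_atom g hg.ne_zero).le_iff.mp hE

/-- A one-dimensional subcoalgebra is spanned by a set-like element. -/
theorem exists_isGroupLikeElem_of_finrank_eq_one {D : Submodule k C} (hD : IsSubcoalgebra k D)
    (h : Module.finrank k D = 1) : ∃ g : C, IsGroupLikeElem k g ∧ D = Submodule.span k {g} := by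
  obtain ⟨⟨v, hv⟩, hv0, hspan⟩ := finrank_eq_one_iff'.mp h
  have hv0' : v ≠ 0 := fun h => hv0 (Subtype.ext h)
  have hspan' : ∀ w ∈ D, ∃ c : k, c • v = w := fun w hw => by
    obtain ⟨c, hc⟩ := hspan ⟨w, hw⟩
    exact ⟨c, congrArg Subtype.val hc⟩
  obtain ⟨c, hc⟩ : ∃ c : k, comul v = c • (v ⊗ₜ[k] v) := by
    obtain ⟨t, ht⟩ := hD v hv
    rw [← ht]
    clear ht
    induction t with
    | zero => exact ⟨0, by simp⟩
    | tmul a b =>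
      obtain ⟨r, hr⟩ := hspan' a a.2
      obtain ⟨s, hs⟩ := hspan' b b.2
      refine ⟨r * s, ?_⟩
      rw [TensorProduct.map_tmul, Submodule.subtype_apply, Submodule.subtype_apply, ← hr, ← hs,
        TensorProduct.smul_tmul_smul]
    | add a b ha hb =>
      obtain ⟨r, hr⟩ := ha
      obtain ⟨s, hs⟩ := hb
      exact ⟨r + s, by rw [map_add, hr, hs, add_smul]⟩
  have hcounit : c * counit (R := k) v = 1 := by
    have h1 := Coalgebra.rTensor_counit_comul (R := k) v
    rw [hc, map_smul, LinearMap.rTensor_tmul] at h1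
    have h2 := congrArg (TensorProduct.lid k C) h1
    rw [map_smul, TensorProduct.lid_tmul, TensorProduct.lid_tmul, smul_smul, one_smul] at h2
    have h3 : (c * counit (R := k) v - 1) • v = 0 := by rw [sub_smul, h2, one_smul, sub_self]
    exact sub_eq_zero.mp ((smul_eq_zero.mp h3).resolve_right hv0')
  have hc0 : c ≠ 0 := left_ne_zero_of_mul_eq_one hcounit
  refine ⟨c • v, ⟨by rw [map_smul, smul_eq_mul, hcounit], ?_⟩, ?_⟩
  · rw [map_smul, hc, TensorProduct.smul_tmul_smul, smul_smul]
  · rw [Submodule.span_singleton_smul_eq hc0.isUnit]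
    refine le_antisymm (fun w hw => Submodule.mem_span_singleton.mpr (hspan' w hw)) ?_
    rwa [Submodule.span_singleton_le_iff_mem]

theorem span_isGroupLikeElem_le_coradical :
    Submodule.span k {g : C | IsGroupLikeElem k g} ≤ coradical k C :=
  Submodule.span_le.mpr fun g hg =>
    le_sSup (a := Submodule.span k {g}) (IsGroupLikeElem.isCosimple_span hg)
      (Submodule.mem_span_singleton_self g)

theorem IsPointedCoalgebra.coradical_eq_span (h : IsPointedCoalgebra k C) :
    coradical k C = Submodule.span k {g : C | IsGroupLikeElem k g} := by
  refine le_antisymm (sSup_le fun D hD => ?_) span_isGroupLikeElem_le_coradical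
  obtain ⟨g, hg, rfl⟩ := exists_isGroupLikeElem_of_finrank_eq_one hD.isSubcoalgebra (h D hD)
  exact Submodule.span_mono (Set.singleton_subset_iff.mpr hg)

end Colors

/-! ### The correspondence -/

section Correspondence

variable {k C : Type*} [Field k] [AddCommGroup C] [Module k C] [Coalgebra k C]

open Coalgebra WithConv

namespace SimplyColored

/-- The projection `ιδ` of a simply colored coalgebra, as a coalgebra endomorphism. -/
noncomputable def projection (S : SimplyColored k C) : C →ₗc[k] C :=
  (colorInclusionHom S.setLike).comp S.δ

theorem projection_apply (S : SimplyColored k C) (x : C) :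
    S.projection x = colorInclusion k S.colors (S.δ x) :=
  rfl

theorem projection_projection (S : SimplyColored k C) (x : C) :
    S.projection (S.projection x) = S.projection x := by
  rw [projection_apply, projection_apply, S.δ_inclusion]

/-- A nonzero subcoalgebra meets the span of the colors: otherwise a functional `f` that kills the
colors and agrees with the counit on `D` would have all its powers equal to the counit on `D`,
while conilpotence makes them vanish eventually. -/
theorem exists_colorInclusion_mem (S : SimplyColored k C) {D : Submodule k C}
    (hD : IsSubcoalgebra k D) (hne : D ≠ ⊥) :
    ∃ a : S.colors →₀ k, a ≠ 0 ∧ colorInclusion k S.colors a ∈ D := by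
  by_contra! hcon
  have hR := isSubcoalgebra_range S.projection
  set R := LinearMap.range S.projection.toLinearMap with hRdef
  have hker : LinearMap.ker (R.mkQ ∘ₗ D.subtype) = ⊥ := by
    refine (Submodule.eq_bot_iff _).mpr fun x hx => ?_
    have hxR : (x : C) ∈ R := by
      simpa using hx
    obtain ⟨y, hy⟩ := hxR
    have hy' : colorInclusion k S.colors (S.δ y) = x := hy
    by_contra hx0
    refine hcon (S.δ y) (fun h0 => hx0 (Subtype.ext ?_)) (hy' ▸ x.2)
    rw [← hy', h0, map_zero, Submodule.coe_zero]
  obtain ⟨r, hr⟩ := LinearMap.exists_leftInverse_of_injective _ hker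
  -- `r` identifies the image of `D` in `C ⧸ R` with `D`; `f` is zero on `R` and the counit on `D`.
  let f : WithConv (C →ₗ[k] k) := toConv (counit ∘ₗ D.subtype ∘ₗ r ∘ₗ R.mkQ)
  have hfR : f ∈ annihilatorIdeal hR := by
    intro x hx
    change counit ((r (R.mkQ x) : D) : C) = 0
    have h0 : R.mkQ x = 0 := (Submodule.Quotient.mk_eq_zero R).mpr hx
    rw [h0, map_zero, Submodule.coe_zero, map_zero]
  have hfD : ∀ x ∈ D, f.ofConv x = counit x := fun x hx =>
    congrArg (fun z : D => counit (R := k) (z : C)) (LinearMap.congr_fun hr ⟨x, hx⟩)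
  have hone : ∀ x : C, (1 : WithConv (C →ₗ[k] k)).ofConv x = counit x := fun x => rfl
  have hpow : ∀ n : ℕ, ∀ x ∈ D, (f ^ n).ofConv x = counit x := by
    intro n
    induction n with
    | zero => exact fun x _ => by rw [pow_zero, hone]
    | succ n ih =>
      intro x hx
      rw [pow_succ, ← apply_leftHit, ih _ (isSubcoalgebra_iff_hit_mem.mp hD x hx f).1, ← hone,
        apply_leftHit, one_mul, hfD x hx]
  -- `x - ιδ x` lies in `ker δ`, and the powers of `f` do not see the summand `ιδ x`.
  have hcounit : ∀ x ∈ D, counit (R := k) x = 0 := by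
    intro x hx
    have hy : S.projection (x - S.projection x) = 0 := by
      rw [map_sub, S.projection_projection, sub_self]
    obtain ⟨N, hN⟩ := S.conilpotent (x - S.projection x)
      (colorInclusion_injective S.setLike (by rw [map_zero]; exact hy))
    obtain ⟨e, he⟩ := exists_apply_iteratedComul S.projection S.projection_projection hfR N
    have h1 := he _ hy
    change e (iteratedComul (reducedComul (colorInclusion k S.colors ∘ₗ S.δ.toLinearMap)) N
      (x - S.projection x)) = _ at h1
    have h2 : f ^ (N + 1) ∈ annihilatorIdeal hR := by
      rw [pow_succ]; exact Ideal.mul_mem_left _ _ hfR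
    rw [hN, map_zero, map_sub, h2 (S.projection x) ⟨x, rfl⟩, sub_zero, hpow _ x hx] at h1
    exact h1.symm
  refine hne ((Submodule.eq_bot_iff _).mpr fun x hx => ext_of_forall_conv k fun g => ?_)
  rw [← one_mul g, ← apply_leftHit, hone, hcounit _ (isSubcoalgebra_iff_hit_mem.mp hD x hx g).1,
    map_zero]

/-- Every nonzero subcoalgebra of a simply colored coalgebra contains a color. -/
theorem exists_color_mem (S : SimplyColored k C) {D : Submodule k C}
    (hD : IsSubcoalgebra k D) (hne : D ≠ ⊥) : ∃ g ∈ S.colors, g ∈ D := by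
  obtain ⟨a, ha, haD⟩ := S.exists_colorInclusion_mem hD hne
  obtain ⟨g, hg⟩ := Finsupp.ne_iff.mp ha
  refine ⟨g, g.2, ?_⟩
  -- The `g`-coefficient of `δ` acts on the span of the colors as the projection onto the line of `g`.
  let f : WithConv (C →ₗ[k] k) := toConv (Finsupp.lapply g ∘ₗ S.δ.toLinearMap)
  have hf : leftHit f ∘ₗ colorInclusion k S.colors =
      (Finsupp.lapply g : (S.colors →₀ k) →ₗ[k] k).smulRight (g : C) := by
    classical
    ext h
    have hδ : S.δ (h : C) = Finsupp.single h 1 := by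
      simpa [colorInclusion] using S.δ_inclusion (Finsupp.single h 1)
    have hδ' : f.ofConv (h : C) = Finsupp.single h (1 : k) g := by rw [← hδ]; rfl
    have h1 : leftHit f (h : C) = Finsupp.single h (1 : k) g • (h : C) := by
      rw [← hδ']
      simp [leftHit, (S.setLike h h.2).comul_eq_tmul_self]
    have h2 : colorInclusion k S.colors (Finsupp.single h 1) = h := by simp [colorInclusion]
    simp only [LinearMap.comp_apply, Finsupp.lsingle_apply, h2, h1, LinearMap.smulRight_apply,
      Finsupp.lapply_apply]
    by_cases hh : h = g
    · rw [hh]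
    · rw [Finsupp.single_eq_of_ne' hh, zero_smul, zero_smul]
  have hmem := (isSubcoalgebra_iff_hit_mem.mp hD _ haD f).1
  have heq : leftHit f (colorInclusion k S.colors a) = a g • (g : C) := LinearMap.congr_fun hf a
  rw [heq] at hmem
  exact (D.smul_mem_iff hg).mp hmem

theorem exists_eq_span_of_isCosimple (S : SimplyColored k C) {D : Submodule k C}
    (hD : IsCosimple D) : ∃ g ∈ S.colors, D = Submodule.span k {g} := by
  obtain ⟨g, hg, hgD⟩ := S.exists_color_mem hD.isSubcoalgebra hD.ne_bot
  have hc := (S.setLike g hg).isCosimple_span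
  exact ⟨g, hg, ((hD.eq_bot_or_eq _ hc.isSubcoalgebra
    ((Submodule.span_singleton_le_iff_mem _ _).mpr hgD)).resolve_left hc.ne_bot).symm⟩

theorem isPointedCoalgebra (S : SimplyColored k C) : IsPointedCoalgebra k C := by
  intro D hD
  obtain ⟨g, hg, rfl⟩ := S.exists_eq_span_of_isCosimple hD
  exact finrank_span_singleton (S.setLike g hg).ne_zero

/-- In a simply colored coalgebra every set-like element is a color. -/
theorem colors_eq (S : SimplyColored k C) : S.colors = {g : C | IsGroupLikeElem k g} := by
  refine Set.Subset.antisymm S.setLike fun g (hg : IsGroupLikeElem k g) => ?_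
  obtain ⟨h, hh, heq⟩ := S.exists_eq_span_of_isCosimple hg.isCosimple_span
  obtain ⟨c, hc⟩ := Submodule.mem_span_singleton.mp (heq ▸ Submodule.mem_span_singleton_self g)
  have hc1 : c = 1 := by
    have := congrArg (counit (R := k)) hc
    rwa [map_smul, (S.setLike h hh).counit_eq_one, hg.counit_eq_one, smul_eq_mul, mul_one] at this
  rw [hc1, one_smul] at hc
  exact hc ▸ hh

theorem range_colorInclusion_eq_coradical (S : SimplyColored k C) :
    LinearMap.range (colorInclusion k S.colors) = coradical k C := by
  rw [range_colorInclusion, S.isPointedCoalgebra.coradical_eq_span, S.colors_eq]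

/-- The pointed coalgebra with a splitting underlying a simply colored coalgebra. -/
noncomputable def toPointedSplitting (S : SimplyColored k C) : PointedSplitting k C where
  pointed := S.isPointedCoalgebra
  δ := CoalgHom.liftInjective coradicalSubtype Subtype.val_injective S.projection
    (S.projection.toLinearMap.codRestrict (coradical k C) fun x => by
      rw [← S.range_colorInclusion_eq_coradical]
      exact ⟨S.δ x, rfl⟩) rfl
  δ_coe x := by
    obtain ⟨a, ha⟩ : (x : C) ∈ LinearMap.range (colorInclusion k S.colors) := by
      rw [S.range_colorInclusion_eq_coradical]
      exact x.2
    refine Subtype.ext ?_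
    change colorInclusion k S.colors (S.δ x) = x
    rw [← ha, S.δ_inclusion]

theorem toPointedSplitting_δ (S : SimplyColored k C) (x : C) :
    (S.toPointedSplitting.δ x : C) = colorInclusion k S.colors (S.δ x) :=
  rfl

/-- A simply colored structure is determined by its projection `ιδ`. -/
theorem ext_of_projection {S T : SimplyColored k C}
    (h : ∀ x, colorInclusion k S.colors (S.δ x) = colorInclusion k T.colors (T.δ x)) : S = T := by
  have hST : S.colors = T.colors := S.colors_eq.trans T.colors_eq.symm
  obtain ⟨G, hG, δ, h1, h2⟩ := S
  obtain ⟨G', hG', δ', h1', h2'⟩ := T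
  obtain rfl : G = G' := hST
  obtain rfl : δ = δ' := CoalgHom.ext fun x => colorInclusion_injective hG (h x)
  rfl

end SimplyColored

namespace PointedSplitting

theorem ext_of_coe {P Q : PointedSplitting k C} (h : ∀ x, (P.δ x : C) = Q.δ x) : P = Q := by
  obtain ⟨hP, δ, h1⟩ := P
  obtain ⟨hQ, δ', h1'⟩ := Q
  obtain rfl : δ = δ' := CoalgHom.ext fun x => Subtype.ext (h x)
  rfl

/-- The splitting, as a coalgebra endomorphism. -/
noncomputable def projection (P : PointedSplitting k C) : C →ₗc[k] C :=
  coradicalSubtype.comp P.δ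

theorem projection_apply (P : PointedSplitting k C) (x : C) : P.projection x = P.δ x :=
  rfl

theorem projection_projection (P : PointedSplitting k C) (x : C) :
    P.projection (P.projection x) = P.projection x := by
  rw [projection_apply, projection_apply, P.δ_coe]

theorem range_projection (P : PointedSplitting k C) :
    LinearMap.range P.projection.toLinearMap = coradical k C := by
  refine le_antisymm ?_ fun x hx => ⟨x, congrArg Subtype.val (P.δ_coe ⟨x, hx⟩)⟩
  rintro _ ⟨x, rfl⟩
  exact (P.δ x).2

/-- The kernel of a splitting is conilpotent, because the image of the splitting is the coradical,
whose annihilator ideal is locally nilpotent. -/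
theorem exists_iteratedComul_eq_zero (P : PointedSplitting k C) {x : C}
    (hx : P.projection x = 0) :
    ∃ N : ℕ, iteratedComul (reducedComul P.projection.toLinearMap) N x = 0 := by
  obtain ⟨n, hn⟩ := exists_pow_annihilatorIdeal_coradical (k := k) x
  refine ⟨n, iteratedComul_eq_zero P.projection P.projection_projection n x hx fun f hf => ?_⟩
  refine hn f (Ideal.pow_le_pow_right n.le_succ ?_)
  have : annihilatorIdeal (isSubcoalgebra_range P.projection) =
      annihilatorIdeal (isSubcoalgebra_coradical (k := k) (C := C)) := by
    ext g
    rw [mem_annihilatorIdeal, mem_annihilatorIdeal, P.range_projection]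
  rwa [← this]

/-- A splitting of a pointed coalgebra takes values in the span of the set-like elements, hence
factors through `C[G]`. -/
theorem exists_simplyColored (P : PointedSplitting k C) :
    ∃ S : SimplyColored k C, S.colors = {g : C | IsGroupLikeElem k g} ∧
      ∀ x : C, colorInclusion k S.colors (S.δ x) = (P.δ x : C) := by
  set G : Set C := {g : C | IsGroupLikeElem k g} with hGdef
  have hG : ∀ g ∈ G, IsGroupLikeElem k g := fun g hg => hg
  have hinj : Function.Injective (colorInclusion k G) := colorInclusion_injective hG
  have hrange : LinearMap.range (colorInclusion k G) = coradical k C := by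
    rw [range_colorInclusion, P.pointed.coradical_eq_span]
  let f : C →ₗ[k] (G →₀ k) := (LinearEquiv.ofInjective _ hinj).symm.toLinearMap ∘ₗ
    P.projection.toLinearMap.codRestrict (LinearMap.range (colorInclusion k G))
      fun x => hrange ▸ (P.δ x).2
  have hf : colorInclusion k G ∘ₗ f = P.projection.toLinearMap := by
    ext x
    exact congrArg Subtype.val (LinearEquiv.apply_symm_apply (LinearEquiv.ofInjective _ hinj) _)
  have hfx : ∀ x, colorInclusion k G (f x) = P.δ x := fun x => LinearMap.congr_fun hf x
  refine ⟨⟨G, hG, CoalgHom.liftInjective (colorInclusionHom hG) hinj P.projection f hf,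
    fun a => hinj ?_, fun x hx => ?_⟩, rfl, hfx⟩
  · refine (hfx _).trans ?_
    have ha : colorInclusion k G a ∈ coradical k C := hrange ▸ ⟨a, rfl⟩
    exact congrArg Subtype.val (P.δ_coe ⟨_, ha⟩)
  · have hx' : P.projection x = 0 := by
      rw [projection_apply, ← hfx, show f x = 0 from hx, map_zero]
    obtain ⟨N, hN⟩ := P.exists_iteratedComul_eq_zero hx'
    refine ⟨N, ?_⟩
    rw [← hf] at hN
    exact hN

end PointedSplitting

end Correspondence

theorem theorem3 {k C : Type*} [Field k] [AddCommGroup C] [Module k C] [Coalgebra k C] :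
    -- every simply colored coalgebra is a pointed coalgebra with a splitting
    (∀ S : SimplyColored k C, ∃ P : PointedSplitting k C,
      ∀ x : C, (P.δ x : C) = colorInclusion k S.colors (S.δ x)) ∧
    -- every pointed coalgebra with a splitting is simply colored by all of its set-like elements
    (∀ P : PointedSplitting k C, ∃ S : SimplyColored k C,
      S.colors = {g : C | IsGroupLikeElem k g} ∧
        ∀ x : C, colorInclusion k S.colors (S.δ x) = (P.δ x : C)) ∧
    -- the two structures on `C` correspond bijectively
    (∃ e : SimplyColored k C ≃ PointedSplitting k C,
      ∀ (S : SimplyColored k C) (x : C),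
        ((e S).δ x : C) = colorInclusion k S.colors (S.δ x)) := by
  refine ⟨fun S => ⟨S.toPointedSplitting, S.toPointedSplitting_δ⟩,
    fun P => P.exists_simplyColored,
    Equiv.ofBijective SimplyColored.toPointedSplitting ⟨fun S T h => ?_, fun P => ?_⟩,
    fun S x => S.toPointedSplitting_δ x⟩
  · refine SimplyColored.ext_of_projection fun x => ?_
    rw [← S.toPointedSplitting_δ, h, T.toPointedSplitting_δ]
  · obtain ⟨S, -, hS⟩ := P.exists_simplyColored
    exact ⟨S, PointedSplitting.ext_of_coe fun x => (S.toPointedSplitting_δ x).trans (hS x)⟩
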